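/- Let $n\ge 0$ be an integer, $f_0\in\mathbb R^n$, and observe $Y=f_0+W$, where $W$ is a random vector of $\mathbb R^n$ that is centered and sub-Gaussian with parameter $\sigma^2$, $\sigma\ge 0$: $\mathbb E W=0$ and $\mathbb E\,e^{\alpha^\top W}\le e^{\sigma^2\|\alpha\|_2^2/2}$ for all $\alpha\in\mathbb R^n$. Let $\mathcal T$ be a measurable space and $(P_t)_{t\in\mathcal T}$ a measurable family of symmetric positive semi-definite real $n\times n$ matrices whose operator norms satisfy $\sup_{t\in\mathcal T}\|P_t\|_2\le V$ for some $V>0$, and put $\hat f_t=P_tY$. Let $\pi$ be a probability measure on $\mathcal T$, $\mathrm{pen}:\mathcal T\to\mathbb R$ measurable, $\beta>4\sigma^2V$, and $$r_t=\|Y-\hat f_t\|_2^2+2\sigma^2\mathrm{tr}(P_t)-n\sigma^2,\qquad d\rho(t)=\frac{\exp\left(-\frac1\beta[r_t+\mathrm{pen}(t)]\right)}{\int\exp\left(-\frac1\beta[r_{t'}+\mathrm{pen}(t')]\right)d\pi(t')}\,d\pi(t),\qquad f_{EWA}=\int\hat f_t\,d\rho(t).$$ Assume $\beta\ge 20\sigma^2V$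 and, for every $t\in\mathcal T$, $$\mathrm{pen}(t)\ge\frac{4\sigma^4}{\beta-4\sigma^2V}\,\mathrm{tr}(P_t^2).$$ Let $$\gamma=\frac{\beta-12\sigma^2V-\sqrt{\beta-4\sigma^2V}\sqrt{\beta-20\sigma^2V}}{16\sigma^2V^2}\quad(\gamma=0\text{ if }\sigma=0),\qquad N=\{\nu>0:(1+\nu)\gamma<1\},$$ $$\mathrm{price}(t)=2\sigma^2\mathrm{tr}(P_t),\qquad \epsilon'(\nu)=\frac1{1-(1+\nu)\gamma}-1,\qquad \epsilon(\nu)=\frac{(1+\nu)^2\gamma}{\nu(1-(1+\nu)\gamma)}.$$ Then, with $\mathcal M_+^1(\mathcal T)$ the set of all probability measures on $\mathcal T$, $KL$ the Kullback–Leibler divergence, all the integrals and infima below taken in $[0,+\infty]$, and $\inf\emptyset=+\infty$: (i) for every $\eta\in(0,1]$, with probability at least $1-\eta$, $$\|f_0-f_{EWA}\|_2^2\le\inf_{\nu\in N}\ \inf_{\mu\in\mathcal M_+^1(\mathcal T)}\Big\{(1+\epsilon(\nu))\int\|f_0-\hat f_t\|_2^2\,d\mu(t)+(1+\epsilon'(\nu))\int(\mathrm{pen}(t)+\mathrm{price}(t))\,d\mu(t)+\beta(1+\epsilon'(\nu))\Big(2KL(\mu,\pi)+\ln\frac1\eta\Big)\Big\};$$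 (ii) $$\mathbb E\|f_0-f_{EWA}\|_2^2\le\inf_{\nu\in N}\ \inf_{\mu\in\mathcal M_+^1(\mathcal T)}\Big\{(1+\epsilon(\nu))\int\mathbb E\|f_0-\hat f_t\|_2^2\,d\mu(t)+(1+\epsilon'(\nu))\int(\mathrm{pen}(t)+\mathrm{price}(t))\,d\mu(t)+2\beta(1+\epsilon'(\nu))KL(\mu,\pi)\Big\}.$$ -/

import Mathlib

open MeasureTheory
open scoped ENNReal

noncomputable section

namespace EWA

/-- A random vector `W` of `ℝⁿ` is centered and sub-Gaussian with parameter `σ²`: `𝔼 W = 0` and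
`𝔼 exp (αᵀ W) ≤ exp (σ² ‖α‖² / 2)` for all `α` (the expectation being finite). -/
structure IsCenteredSubGaussian {n : ℕ} {Ω : Type*} [MeasurableSpace Ω]
    (W : Ω → EuclideanSpace ℝ (Fin n)) (σ : ℝ) (Pr : Measure Ω) : Prop where
  measurable : Measurable W
  centered : ∫ ω, W ω ∂Pr = 0
  integrable_exp : ∀ α : EuclideanSpace ℝ (Fin n),
    Integrable (fun ω => Real.exp (inner ℝ α (W ω))) Pr
  expectation_exp_le : ∀ α : EuclideanSpace ℝ (Fin n),
    ∫ ω, Real.exp (inner ℝ α (W ω)) ∂Pr ≤ Real.exp (σ ^ 2 / 2 * ‖α‖ ^ 2)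

/-- The linear estimate `P Y`, a vector of Euclidean space. -/
def linEst {n : ℕ} (P : Matrix (Fin n) (Fin n) ℝ) (Y : EuclideanSpace ℝ (Fin n)) :
    EuclideanSpace ℝ (Fin n) :=
  Matrix.toEuclideanCLM (𝕜 := ℝ) P Y

/-- Stein's unbiased estimate of the risk of `P Y`:
`‖Y - P Y‖² + 2 σ² tr P - n σ²`. -/
def steinRisk {n : ℕ} (σ : ℝ) (P : Matrix (Fin n) (Fin n) ℝ) (Y : EuclideanSpace ℝ (Fin n)) : ℝ :=
  ‖Y - linEst P Y‖ ^ 2 + 2 * σ ^ 2 * P.trace - n * σ ^ 2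

/-- The exponential weights: the probability measure `ρ` on `T` with density proportional to
`exp (-(r_t + pen t) / β)` with respect to the prior measure `prior`. -/
def weights {n : ℕ} {T : Type*} [MeasurableSpace T] (σ β : ℝ) (P : T → Matrix (Fin n) (Fin n) ℝ)
    (pen : T → ℝ) (prior : Measure T) (Y : EuclideanSpace ℝ (Fin n)) : Measure T :=
  prior.tilted (fun t => -(1 / β) * (steinRisk σ (P t) Y + pen t))

/-- The exponentially weighted aggregate `f_EWA = ∫ P_t Y dρ(t)`. -/
def aggregate {n : ℕ} {T : Type*} [MeasurableSpace T] (σ β : ℝ) (P : T → Matrix (Fin n) (Fin n) ℝ)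
    (pen : T → ℝ) (prior : Measure T) (Y : EuclideanSpace ℝ (Fin n)) : EuclideanSpace ℝ (Fin n) :=
  ∫ t, linEst (P t) Y ∂(weights σ β P pen prior Y)

/-- The constant `γ`. For `σ = 0` this is `0`, which is also the limit as `σ → 0`. -/
def gam (σ V β : ℝ) : ℝ :=
  (β - 12 * σ ^ 2 * V - √(β - 4 * σ ^ 2 * V) * √(β - 20 * σ ^ 2 * V)) / (16 * σ ^ 2 * V ^ 2)

/-- The admissible parameters `N = {ν > 0 | (1 + ν) γ < 1}`. -/
def admissible (γ : ℝ) : Set ℝ := {ν | 0 < ν ∧ (1 + ν) * γ < 1}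

/-- `ε'(ν) = 1 / (1 - (1 + ν) γ) - 1`. -/
def eps' (γ ν : ℝ) : ℝ := 1 / (1 - (1 + ν) * γ) - 1

/-- `ε(ν) = (1 + ν)² γ / (ν (1 - (1 + ν) γ))`. -/
def eps (γ ν : ℝ) : ℝ := (1 + ν) ^ 2 * γ / (ν * (1 - (1 + ν) * γ))

theorem eps_eq (γ ν : ℝ) : eps γ ν = (1 + ν) ^ 2 / ν * γ * (1 + eps' γ ν) := by
  simp only [eps, eps', div_eq_mul_inv, mul_inv]
  ring

/-- `price = 2 σ² tr P`. -/
def price {n : ℕ} (σ : ℝ) (P : Matrix (Fin n) (Fin n) ℝ) : ℝ := 2 * σ ^ 2 * P.trace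

end EWA

end

/-!
Write `R t = ‖f₀ - P_t Y‖²` for the loss, `r t` for Stein's estimate and `D = P_t - P_u`. Expanding
the squares with `Y = f₀ + W` gives

`R t - R u - (r t - r u) - price u = 2 ⟪D f₀, W⟫ + 2 ⟪W, P_t W⟫ - 2 σ² tr P_t - 2 ⟪W, P_u W⟫`,

so a difference of losses is a difference of Stein estimates up to a linear and a quadratic form in
the noise. The last term is nonpositive and is dropped, since sub-Gaussianity gives no lower bound on
`⟪W, P_u W⟫` that would offset `2 σ² tr P_u`; this is why `price u` has to be paid.

*Exponential moment* (`IsCenteredSubGaussian.lintegral_exp_logExcess_le`). The quantity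
`R t - R u - r t + r u - price u - pen t - γ ‖P_t Y - P_u Y‖²`, divided by `β`, has exponential
moment at most `1` for all `t, u`. The quadratic form `⟪W, P_t W⟫` is diagonalized in an eigenbasis
of `P_t`, and each `exp (c² x² / 2)` is written as `𝔼 exp (c ξ x)` with `ξ` standard Gaussian. Then
the exponent is linear in `W`, the sub-Gaussian hypothesis applies, and one-dimensional Gaussian
integrals remain. They produce `2 σ² tr P_t`, a second-order term compensated by the lower bound on
`pen t`, and a multiple of `‖(1 - γ D) D f₀‖²`, which `γ ‖D f₀‖²` compensates by the quadratic
equation for `γ` (`gam_quadratic`).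

*Change of measure* (`integral_integral_tilted_le`). The Donsker-Varadhan inequality, applied on
both factors of `T × T`, turns the exponential moment into a bound on the integral over `ρ ⊗ μ`,
where `ρ` is the tilted prior. The divergence of `ρ` and its penalty cancel because `ρ` is a Gibbs
measure; what remains is `2 KL(μ, π)` plus the logarithm of the exponential moment averaged over
`π ⊗ π`.

*Conclusion.* The term `‖P_t Y - P_u Y‖² ≤ (1 + ν) R t + (1 + 1/ν) R u` is absorbed in the losses,
which gives the factors `1 + ε(ν)` and `1 + ε'(ν)`, and Jensen's inequality bounds the loss of the
aggregate by `∫ R dρ` (`normSq_sub_aggregate_le`). The averaged exponential moment has expectation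
at most `1`: Markov's inequality yields the bound in probability, and `log x ≤ x - 1` the bound in
expectation.
-/

namespace EWA

/-! ### Exponential moments of quadratic forms in sub-Gaussian vectors -/

section SubGaussian

open ProbabilityTheory

theorem sqrt_inv_one_sub_le_exp {q : ℝ} (hq : 0 ≤ q) (hq1 : q < 1) :
    √(1 - q)⁻¹ ≤ Real.exp (q / 2 + q ^ 2 / (4 * (1 - q))) := by
  have h1 : 0 < 1 - q := by linarith
  -- This is `x ≤ sinh x` at `x = log (1 - q)⁻¹`.
  have hlog : Real.log (1 - q)⁻¹ ≤ ((1 - q)⁻¹ - (1 - q)⁻¹⁻¹) / 2 := by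
    rw [← Real.sinh_log (inv_pos.2 h1), Real.self_le_sinh_iff]
    exact Real.log_nonneg (one_le_inv_iff₀.2 ⟨h1, by linarith⟩)
  rw [← Real.exp_log (inv_pos.2 h1), ← Real.exp_half, Real.exp_le_exp]
  calc Real.log (1 - q)⁻¹ / 2 ≤ ((1 - q)⁻¹ - (1 - q)⁻¹⁻¹) / 2 / 2 := by gcongr
    _ = q / 2 + q ^ 2 / (4 * (1 - q)) := by
      field_simp
      ring

/-- Completing the square: the standard Gaussian density times `exp (s (a + c x)² / 2)` is a
multiple of the Gaussian density with variance `(1 - s c²)⁻¹`. -/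
theorem gaussianPDFReal_mul_exp_sq (s a c x : ℝ) (hq : s * c ^ 2 < 1) :
    gaussianPDFReal 0 1 x * Real.exp (s / 2 * (a + c * x) ^ 2) =
      (√(1 - s * c ^ 2)⁻¹ * Real.exp (s * a ^ 2 / (2 * (1 - s * c ^ 2)))) *
        gaussianPDFReal (s * a * c / (1 - s * c ^ 2)) (Real.toNNReal (1 - s * c ^ 2)⁻¹) x := by
  have h1 : 0 < 1 - s * c ^ 2 := by linarith
  have hv : ((Real.toNNReal (1 - s * c ^ 2)⁻¹ : NNReal) : ℝ) = (1 - s * c ^ 2)⁻¹ :=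
    Real.coe_toNNReal _ (inv_pos.2 h1).le
  have hs : √(1 - s * c ^ 2)⁻¹ ≠ 0 := (Real.sqrt_pos.2 (inv_pos.2 h1)).ne'
  rw [gaussianPDFReal, gaussianPDFReal, hv, Real.sqrt_mul (by positivity) (1 - s * c ^ 2)⁻¹,
    NNReal.coe_one, mul_one, mul_inv]
  rw [mul_assoc, ← Real.exp_add]
  -- Collect the exponentials and the two occurrences of the square root.
  rw [show ∀ A B C D E : ℝ, A * B * (C * D * E) = (A * D) * (C * (B * E)) by intros; ring,
    ← Real.exp_add, mul_inv_cancel₀ hs, one_mul]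
  congr 2
  field_simp
  ring

theorem integrable_exp_sq_gaussianReal (s a c : ℝ) (hq : s * c ^ 2 < 1) :
    Integrable (fun x => Real.exp (s / 2 * (a + c * x) ^ 2)) (gaussianReal 0 1) := by
  rw [gaussianReal_of_var_ne_zero 0 one_ne_zero, gaussianPDF_def,
    integrable_withDensity_iff_integrable_smul' (by fun_prop) (by simp)]
  refine ((integrable_gaussianPDFReal (s * a * c / (1 - s * c ^ 2))
    (Real.toNNReal (1 - s * c ^ 2)⁻¹)).const_mul
    (√(1 - s * c ^ 2)⁻¹ * Real.exp (s * a ^ 2 / (2 * (1 - s * c ^ 2))))).congr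
    (Filter.Eventually.of_forall fun x => ?_)
  simp only [smul_eq_mul]
  rw [ENNReal.toReal_ofReal (gaussianPDFReal_nonneg _ _ _), gaussianPDFReal_mul_exp_sq s a c x hq]

theorem integral_exp_sq_gaussianReal (s a c : ℝ) (hq : s * c ^ 2 < 1) :
    ∫ x, Real.exp (s / 2 * (a + c * x) ^ 2) ∂(gaussianReal 0 1) =
      √(1 - s * c ^ 2)⁻¹ * Real.exp (s * a ^ 2 / (2 * (1 - s * c ^ 2))) := by
  have h1 : 0 < 1 - s * c ^ 2 := by linarith
  rw [integral_gaussianReal_eq_integral_smul one_ne_zero]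
  simp only [smul_eq_mul, gaussianPDFReal_mul_exp_sq s a c _ hq]
  rw [integral_const_mul, integral_gaussianPDFReal_eq_one, mul_one]
  exact (Real.toNNReal_pos.2 (inv_pos.2 h1)).ne'

theorem integral_exp_sq_gaussianReal_le {s a c κ : ℝ} (hs : 0 ≤ s) (hκ : s * c ^ 2 ≤ κ)
    (hκ1 : κ < 1) :
    ∫ x, Real.exp (s / 2 * (a + c * x) ^ 2) ∂(gaussianReal 0 1) ≤
      Real.exp (s * c ^ 2 / 2 + (s * c ^ 2) ^ 2 / (4 * (1 - κ)) + s * a ^ 2 / (2 * (1 - κ))) := by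
  have hq0 : 0 ≤ s * c ^ 2 := by positivity
  have h1 : 0 < 1 - κ := by linarith
  rw [integral_exp_sq_gaussianReal s a c (by linarith), Real.exp_add]
  gcongr
  refine (sqrt_inv_one_sub_le_exp hq0 (by linarith)).trans ?_
  gcongr

theorem integral_exp_mul_gaussianReal (x : ℝ) :
    ∫ y, Real.exp (x * y) ∂(gaussianReal 0 1) = Real.exp (x ^ 2 / 2) := by
  have := congrFun (mgf_id_gaussianReal (μ := 0) (v := 1)) x
  simpa [mgf] using this

variable {n : ℕ} {Ω : Type*} [MeasurableSpace Ω]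

/-- The exponential of `⟪a, w⟫ + ∑ c_i² ⟪b_i, w⟫² / 2` is a Gaussian average of exponentials of
linear forms in `w`. -/
theorem lintegral_exp_linear_gaussian (b : OrthonormalBasis (Fin n) ℝ (EuclideanSpace ℝ (Fin n)))
    (c : Fin n → ℝ) (a w : EuclideanSpace ℝ (Fin n)) :
    ∫⁻ ξ, ENNReal.ofReal (Real.exp (inner ℝ (a + ∑ i, (c i * ξ i) • b i) w))
        ∂(Measure.pi fun _ : Fin n => gaussianReal 0 1) =
      ENNReal.ofReal (Real.exp (inner ℝ a w + ∑ i, (c i) ^ 2 / 2 * (inner ℝ (b i) w) ^ 2)) := by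
  have hexp : ∀ ξ : Fin n → ℝ, Real.exp (inner ℝ (a + ∑ i, (c i * ξ i) • b i) w) =
      Real.exp (inner ℝ a w) * ∏ i, Real.exp (c i * inner ℝ (b i) w * ξ i) := by
    intro ξ
    rw [← Real.exp_sum, ← Real.exp_add, inner_add_left, sum_inner]
    congr 2
    refine Finset.sum_congr rfl fun i _ => ?_
    rw [real_inner_smul_left]
    ring
  simp only [hexp]
  rw [← ofReal_integral_eq_lintegral_ofReal, integral_const_mul,
    integral_fintype_prod_eq_prod (f := fun i y => Real.exp (c i * inner ℝ (b i) w * y))]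
  · simp only [integral_exp_mul_gaussianReal]
    rw [← Real.exp_sum, ← Real.exp_add]
    congr 3
    exact Finset.sum_congr rfl fun i _ => by ring
  · refine Integrable.const_mul (Integrable.fintype_prod
      (f := fun i y => Real.exp (c i * inner ℝ (b i) w * y)) fun i => ?_) _
    exact integrable_exp_mul_gaussianReal _
  · exact Filter.Eventually.of_forall fun ξ => by positivity

/-- In the orthonormal basis `b` the integral factors into one-dimensional Gaussian integrals. -/
theorem lintegral_exp_normSq_gaussian_le
    (b : OrthonormalBasis (Fin n) ℝ (EuclideanSpace ℝ (Fin n)))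
    {c : Fin n → ℝ} (a : EuclideanSpace ℝ (Fin n)) {s κ : ℝ} (hs : 0 ≤ s)
    (hκ : ∀ i, s * c i ^ 2 ≤ κ) (hκ1 : κ < 1) :
    ∫⁻ ξ, ENNReal.ofReal (Real.exp (s / 2 * ‖a + ∑ i, (c i * ξ i) • b i‖ ^ 2))
        ∂(Measure.pi fun _ : Fin n => gaussianReal 0 1) ≤
      ENNReal.ofReal (Real.exp ((∑ i, (s * c i ^ 2 / 2 + (s * c i ^ 2) ^ 2 / (4 * (1 - κ)))) +
        s * ‖a‖ ^ 2 / (2 * (1 - κ)))) := by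
  have hq : ∀ i, s * c i ^ 2 < 1 := fun i => (hκ i).trans_lt hκ1
  have hexp : ∀ ξ : Fin n → ℝ, Real.exp (s / 2 * ‖a + ∑ i, (c i * ξ i) • b i‖ ^ 2) =
      ∏ i, Real.exp (s / 2 * (inner ℝ (b i) a + c i * ξ i) ^ 2) := by
    intro ξ
    rw [← Real.exp_sum, ← OrthonormalBasis.sum_sq_inner_right b, Finset.mul_sum]
    congr 1
    refine Finset.sum_congr rfl fun i _ => ?_
    rw [inner_add_right, inner_sum]
    simp [real_inner_smul_right, orthonormal_iff_ite.1 b.orthonormal]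
  simp only [hexp]
  rw [← ofReal_integral_eq_lintegral_ofReal,
    integral_fintype_prod_eq_prod
      (f := fun i y => Real.exp (s / 2 * (inner ℝ (b i) a + c i * y) ^ 2))]
  · refine ENNReal.ofReal_le_ofReal ?_
    refine (Finset.prod_le_prod (fun i _ => integral_nonneg fun x => (Real.exp_pos _).le)
      fun i _ => integral_exp_sq_gaussianReal_le (a := inner ℝ (b i) a) hs (hκ i) hκ1).trans_eq ?_
    rw [← Real.exp_sum, Finset.sum_add_distrib, ← OrthonormalBasis.sum_sq_inner_right b a,
      Finset.mul_sum, Finset.sum_div]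
  · exact Integrable.fintype_prod
      (f := fun i y => Real.exp (s / 2 * (inner ℝ (b i) a + c i * y) ^ 2))
      fun i => integrable_exp_sq_gaussianReal _ _ _ (hq i)
  · exact Filter.Eventually.of_forall fun ξ => by positivity

/-- Exponential moment of a quadratic polynomial in a sub-Gaussian vector, the quadratic part being
diagonal in the orthonormal basis `b`. After the Gaussian linearization of the quadratic part, the
order of integration is exchanged and the sub-Gaussian bound is used inside. -/
theorem IsCenteredSubGaussian.lintegral_exp_quadratic_le {W : Ω → EuclideanSpace ℝ (Fin n)} {σ : ℝ}
    {Pr : Measure Ω} [IsProbabilityMeasure Pr] (hW : IsCenteredSubGaussian W σ Pr)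
    (b : OrthonormalBasis (Fin n) ℝ (EuclideanSpace ℝ (Fin n)))
    {c : Fin n → ℝ} (a : EuclideanSpace ℝ (Fin n)) {κ : ℝ}
    (hκ : ∀ i, σ ^ 2 * c i ^ 2 ≤ κ) (hκ1 : κ < 1) :
    ∫⁻ ω, ENNReal.ofReal (Real.exp (inner ℝ a (W ω) +
        ∑ i, (c i) ^ 2 / 2 * (inner ℝ (b i) (W ω)) ^ 2)) ∂Pr ≤
      ENNReal.ofReal (Real.exp
        ((∑ i, (σ ^ 2 * c i ^ 2 / 2 + (σ ^ 2 * c i ^ 2) ^ 2 / (4 * (1 - κ)))) +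
          σ ^ 2 * ‖a‖ ^ 2 / (2 * (1 - κ)))) := by
  have hWm := hW.measurable
  simp only [← lintegral_exp_linear_gaussian]
  rw [lintegral_lintegral_swap (by
    refine Measurable.aemeasurable ?_
    simp only [Function.uncurry_def]
    fun_prop)]
  refine le_trans (lintegral_mono fun ξ => ?_)
    (lintegral_exp_normSq_gaussian_le b a (sq_nonneg σ) hκ hκ1)
  rw [← ofReal_integral_eq_lintegral_ofReal (hW.integrable_exp _)
    (Filter.Eventually.of_forall fun _ => (Real.exp_pos _).le)]
  exact ENNReal.ofReal_le_ofReal (hW.expectation_exp_le _)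

end SubGaussian

/-! ### Positive semidefinite matrices acting on Euclidean space -/

section LinearEstimates

variable {n : ℕ} {Ω : Type*} [MeasurableSpace Ω]

theorem trace_sq_eq_sum_eigenvalues {P : Matrix (Fin n) (Fin n) ℝ} (hP : P.IsHermitian) :
    (P ^ 2).trace = ∑ i, hP.eigenvalues i ^ 2 := by
  conv_lhs => rw [hP.spectral_theorem]
  rw [← map_pow, Unitary.conjStarAlgAut_apply, Matrix.trace_mul_cycle, Matrix.diagonal_pow,
    Unitary.coe_star_mul_self, one_mul, Matrix.trace_diagonal]
  simp

theorem trace_sq_nonneg {P : Matrix (Fin n) (Fin n) ℝ} (hP : P.IsHermitian) :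
    0 ≤ (P ^ 2).trace := by
  rw [trace_sq_eq_sum_eigenvalues hP]
  positivity

theorem linEst_eigenvectorBasis {P : Matrix (Fin n) (Fin n) ℝ} (hP : P.IsHermitian) (i : Fin n) :
    linEst P (hP.eigenvectorBasis i) = hP.eigenvalues i • hP.eigenvectorBasis i := by
  apply (WithLp.ofLp_injective 2)
  simpa [linEst, Matrix.ofLp_toEuclideanCLM] using hP.mulVec_eigenvectorBasis i

theorem inner_linEst_left {P : Matrix (Fin n) (Fin n) ℝ} (hP : P.IsHermitian)
    (x y : EuclideanSpace ℝ (Fin n)) : inner ℝ (linEst P x) y = inner ℝ x (linEst P y) := by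
  rw [linEst, linEst, ← ContinuousLinearMap.adjoint_inner_right,
    ← ContinuousLinearMap.star_eq_adjoint, ← map_star, Matrix.star_eq_conjTranspose, hP.eq]

theorem inner_linEst_self {P : Matrix (Fin n) (Fin n) ℝ} (hP : P.IsHermitian)
    (x : EuclideanSpace ℝ (Fin n)) :
    inner ℝ x (linEst P x) =
      ∑ i, hP.eigenvalues i * (inner ℝ (hP.eigenvectorBasis i) x) ^ 2 := by
  rw [← hP.eigenvectorBasis.sum_inner_mul_inner x]
  refine Finset.sum_congr rfl fun i _ => ?_
  rw [← inner_linEst_left hP, linEst_eigenvectorBasis, real_inner_smul_left,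
    real_inner_comm _ x]
  ring

theorem inner_linEst_self_nonneg {P : Matrix (Fin n) (Fin n) ℝ} (hP : P.PosSemidef)
    (x : EuclideanSpace ℝ (Fin n)) : 0 ≤ inner ℝ x (linEst P x) := by
  rw [inner_linEst_self hP.isHermitian]
  exact Finset.sum_nonneg fun i _ => mul_nonneg (hP.eigenvalues_nonneg i) (sq_nonneg _)

theorem norm_linEst_le {P : Matrix (Fin n) (Fin n) ℝ} {V : ℝ}
    (hPV : ‖Matrix.toEuclideanCLM (𝕜 := ℝ) P‖ ≤ V) (x : EuclideanSpace ℝ (Fin n)) :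
    ‖linEst P x‖ ≤ V * ‖x‖ :=
  (Matrix.toEuclideanCLM (𝕜 := ℝ) P).le_of_opNorm_le hPV x

theorem eigenvalues_le {P : Matrix (Fin n) (Fin n) ℝ} (hP : P.IsHermitian) {V : ℝ}
    (hPV : ‖Matrix.toEuclideanCLM (𝕜 := ℝ) P‖ ≤ V) (i : Fin n) : hP.eigenvalues i ≤ V := by
  have h := norm_linEst_le hPV (hP.eigenvectorBasis i)
  rw [linEst_eigenvectorBasis, norm_smul, hP.eigenvectorBasis.orthonormal.1 i, mul_one,
    mul_one] at h
  exact (le_abs_self _).trans h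

/-- The quadratic form `2 ⟪W, P W⟫` and the linear form `2 ⟪a, W⟫`, corrected by their costs at
temperature `β`, have exponential moment at most `1`. -/
theorem IsCenteredSubGaussian.lintegral_exp_linEst_le {W : Ω → EuclideanSpace ℝ (Fin n)} {σ : ℝ}
    {Pr : Measure Ω} [IsProbabilityMeasure Pr] (hW : IsCenteredSubGaussian W σ Pr)
    {P : Matrix (Fin n) (Fin n) ℝ} (hP : P.PosSemidef) {V β : ℝ} (hV : 0 < V)
    (hPV : ‖Matrix.toEuclideanCLM (𝕜 := ℝ) P‖ ≤ V) (hβ : 4 * σ ^ 2 * V < β)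
    (a : EuclideanSpace ℝ (Fin n)) :
    ∫⁻ ω, ENNReal.ofReal (Real.exp (1 / β * (2 * inner ℝ a (W ω)
        + 2 * inner ℝ (W ω) (linEst P (W ω)) - 2 * σ ^ 2 * P.trace
        - 4 * σ ^ 4 / (β - 4 * σ ^ 2 * V) * (P ^ 2).trace
        - 2 * σ ^ 2 / (β - 4 * σ ^ 2 * V) * ‖a‖ ^ 2))) ∂Pr ≤ 1 := by
  have hβ0 : 0 < β := lt_of_le_of_lt (by positivity) hβ
  have hd : 0 < β - 4 * σ ^ 2 * V := by linarith
  have hH := hP.isHermitian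
  set p := hH.eigenvalues with hp
  have hp0 : ∀ i, 0 ≤ p i := hP.eigenvalues_nonneg
  have hpV : ∀ i, p i ≤ V := eigenvalues_le hH hPV
  have htr : P.trace = ∑ i, p i := by simpa using hH.trace_eq_sum_eigenvalues
  have hc : ∀ i, √(4 / β * p i) ^ 2 = 4 / β * p i :=
    fun i => Real.sq_sqrt (mul_nonneg (by positivity) (hp0 i))
  -- With `c_i² = 4 p_i / β` the quadratic part is `(2 / β) ⟪W, P W⟫`, and `p_i ≤ V` gives `κ`.
  have key := hW.lintegral_exp_quadratic_le hH.eigenvectorBasis (c := fun i => √(4 / β * p i))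
    ((2 / β) • a) (κ := 4 * σ ^ 2 * V / β)
    (fun i => by
      rw [hc]
      calc σ ^ 2 * (4 / β * p i) = 4 * σ ^ 2 * p i / β := by ring
        _ ≤ _ := by gcongr; exact hpV i)
    ((div_lt_one hβ0).2 hβ)
  simp only [hc] at key
  set S := (∑ i, (σ ^ 2 * (4 / β * p i) / 2 +
    (σ ^ 2 * (4 / β * p i)) ^ 2 / (4 * (1 - 4 * σ ^ 2 * V / β)))) +
          σ ^ 2 * ‖(2 / β) • a‖ ^ 2 / (2 * (1 - 4 * σ ^ 2 * V / β)) with hSdef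
  have hS : S = 1 / β * (2 * σ ^ 2 * P.trace + 4 * σ ^ 4 / (β - 4 * σ ^ 2 * V) * (P ^ 2).trace
        + 2 * σ ^ 2 / (β - 4 * σ ^ 2 * V) * ‖a‖ ^ 2) := by
    have h1 : 1 - 4 * σ ^ 2 * V / β = (β - 4 * σ ^ 2 * V) / β := by field_simp
    rw [hSdef, htr, trace_sq_eq_sum_eigenvalues hH, h1, norm_smul, Real.norm_eq_abs,
      abs_of_pos (by positivity : 0 < 2 / β), mul_add, mul_add, Finset.sum_add_distrib,
      Finset.mul_sum, Finset.mul_sum, Finset.mul_sum, Finset.mul_sum]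
    congr 1
    · congr 1
      · exact Finset.sum_congr rfl fun i _ => by field_simp; ring
      · exact Finset.sum_congr rfl fun i _ => by field_simp; ring
    · field_simp
  have hpt : ∀ ω, ENNReal.ofReal (Real.exp (1 / β * (2 * inner ℝ a (W ω)
        + 2 * inner ℝ (W ω) (linEst P (W ω)) - 2 * σ ^ 2 * P.trace
        - 4 * σ ^ 4 / (β - 4 * σ ^ 2 * V) * (P ^ 2).trace
        - 2 * σ ^ 2 / (β - 4 * σ ^ 2 * V) * ‖a‖ ^ 2))) =
      ENNReal.ofReal (Real.exp (-S)) * ENNReal.ofReal (Real.exp (inner ℝ ((2 / β) • a) (W ω) +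
        ∑ i, (4 / β * p i) / 2 * (inner ℝ (hH.eigenvectorBasis i) (W ω)) ^ 2)) := by
    intro ω
    rw [← ENNReal.ofReal_mul (Real.exp_pos _).le, ← Real.exp_add, hS, inner_linEst_self hH,
      real_inner_smul_left]
    congr 2
    have : ∑ i, (4 / β * p i) / 2 * (inner ℝ (hH.eigenvectorBasis i) (W ω)) ^ 2 =
        2 / β * ∑ i, p i * (inner ℝ (hH.eigenvectorBasis i) (W ω)) ^ 2 := by
      rw [Finset.mul_sum]
      exact Finset.sum_congr rfl fun i _ => by ring
    rw [this]
    ring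
  simp only [hpt]
  rw [lintegral_const_mul' _ _ ENNReal.ofReal_ne_top]
  calc _ ≤ ENNReal.ofReal (Real.exp (-S)) * ENNReal.ofReal (Real.exp S) := by gcongr
    _ = 1 := by
      rw [← ENNReal.ofReal_mul (Real.exp_pos _).le, ← Real.exp_add, neg_add_cancel, Real.exp_zero,
        ENNReal.ofReal_one]

/-! ### The constant `γ` and the excess -/

theorem gam_nonneg {σ V β : ℝ} (hV : 0 < V) (hβ' : 20 * σ ^ 2 * V ≤ β) : 0 ≤ gam σ V β := by
  have hs : 0 ≤ σ ^ 2 * V := by positivity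
  refine div_nonneg ?_ (by positivity)
  rw [← Real.sqrt_mul (by linarith), sub_nonneg, Real.sqrt_le_left (by linarith)]
  nlinarith

/-- The equation defining `γ`: the variance of the linear form `2 ⟪(1 - γ D) g, W⟫`, where
`‖D‖ ≤ 2 V`, then costs at most `γ ‖g‖²`. It also holds for `σ = 0`, where `γ = 0`. -/
theorem gam_quadratic {σ V β : ℝ} (hV : 0 < V) (hβ' : 20 * σ ^ 2 * V ≤ β) :
    2 * σ ^ 2 * (1 + 2 * (gam σ V β * V)) ^ 2 = gam σ V β * (β - 4 * σ ^ 2 * V) := by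
  rcases eq_or_ne σ 0 with rfl | hσ
  · simp [gam]
  have hs : 0 ≤ σ ^ 2 * V := by positivity
  have hg : 16 * σ ^ 2 * V ^ 2 * gam σ V β = β - 12 * σ ^ 2 * V -
      √(β - 4 * σ ^ 2 * V) * √(β - 20 * σ ^ 2 * V) :=
    mul_div_cancel₀ _ (by positivity)
  set D := √(β - 4 * σ ^ 2 * V) * √(β - 20 * σ ^ 2 * V) with hD
  have hD2 : D ^ 2 = (β - 4 * σ ^ 2 * V) * (β - 20 * σ ^ 2 * V) := by
    rw [hD, mul_pow, Real.sq_sqrt (by linarith), Real.sq_sqrt (by linarith)]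
  have hDe : D = β - 12 * σ ^ 2 * V - 16 * σ ^ 2 * V ^ 2 * gam σ V β := by linarith
  rw [hDe] at hD2
  -- Times `32 σ² V²`, the claim is the formula for the square of `D`.
  have h32 : 32 * σ ^ 2 * V ^ 2 ≠ 0 := by positivity
  apply mul_left_cancel₀ h32
  linear_combination hD2

/-- The excess of the loss at `t` over the loss at `u` that Stein's estimates, the price at `u`, the
penalty at `t` and `γ ‖P_t Y - P_u Y‖²` do not account for, on the scale `1 / β`. -/
noncomputable def logExcess {T : Type*} (σ V β : ℝ) (P : T → Matrix (Fin n) (Fin n) ℝ) (pen : T → ℝ)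
    (f₀ Y : EuclideanSpace ℝ (Fin n)) (t u : T) : ℝ :=
  1 / β * (‖f₀ - linEst (P t) Y‖ ^ 2 - ‖f₀ - linEst (P u) Y‖ ^ 2 - steinRisk σ (P t) Y
    + steinRisk σ (P u) Y - price σ (P u) - pen t
    - gam σ V β * ‖linEst (P t) Y - linEst (P u) Y‖ ^ 2)

theorem linEst_add (P : Matrix (Fin n) (Fin n) ℝ) (x y : EuclideanSpace ℝ (Fin n)) :
    linEst P (x + y) = linEst P x + linEst P y := map_add _ x y

/-- The loss minus Stein's estimate of it, when the observation is `f₀ + w`. The last bracket does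
not depend on `P`. -/
theorem risk_sub_steinRisk (σ : ℝ) (P : Matrix (Fin n) (Fin n) ℝ)
    (f₀ w : EuclideanSpace ℝ (Fin n)) :
    ‖f₀ - linEst P (f₀ + w)‖ ^ 2 - steinRisk σ P (f₀ + w) =
      2 * inner ℝ (linEst P f₀) w + 2 * inner ℝ w (linEst P w) - 2 * σ ^ 2 * P.trace
        + (n * σ ^ 2 - ‖w‖ ^ 2 - 2 * inner ℝ f₀ w) := by
  have h : f₀ + w - linEst P (f₀ + w) = (f₀ - linEst P (f₀ + w)) + w := by abel
  rw [steinRisk, h, norm_add_sq_real, inner_sub_left, linEst_add, inner_add_left,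
    real_inner_comm _ (linEst P w)]
  ring

/-- For fixed `t` and `u` the excess has exponential moment at most `1`. With `D = P_t - P_u` and
`g = D f₀`, the terms `-2 ⟪W, P_u W⟫` and `-γ ‖D W‖²` are nonpositive and are dropped, and the
linear form that remains is `2 ⟪g - γ D g, W⟫`. -/
theorem IsCenteredSubGaussian.lintegral_exp_logExcess_le {W : Ω → EuclideanSpace ℝ (Fin n)} {σ : ℝ}
    {Pr : Measure Ω} [IsProbabilityMeasure Pr] (hW : IsCenteredSubGaussian W σ Pr)
    {T : Type*} {P : T → Matrix (Fin n) (Fin n) ℝ} (hP : ∀ t, (P t).PosSemidef) {V β : ℝ}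
    (hV : 0 < V) (hPV : ∀ t, ‖Matrix.toEuclideanCLM (𝕜 := ℝ) (P t)‖ ≤ V)
    (hβ : 4 * σ ^ 2 * V < β) (hβ' : 20 * σ ^ 2 * V ≤ β) {pen : T → ℝ}
    (hpen : ∀ t, 4 * σ ^ 4 / (β - 4 * σ ^ 2 * V) * (P t ^ 2).trace ≤ pen t)
    (f₀ : EuclideanSpace ℝ (Fin n)) (t u : T) :
    ∫⁻ ω, ENNReal.ofReal (Real.exp (logExcess σ V β P pen f₀ (f₀ + W ω) t u)) ∂Pr ≤ 1 := by
  have hβ0 : 0 < β := lt_of_le_of_lt (by positivity) hβ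
  have hd : 0 < β - 4 * σ ^ 2 * V := by linarith
  set γ := gam σ V β with hγ
  have hγ0 : 0 ≤ γ := gam_nonneg hV hβ'
  set g := linEst (P t) f₀ - linEst (P u) f₀ with hg
  set Dg := linEst (P t) g - linEst (P u) g with hDg
  have hDg_norm : ‖Dg‖ ≤ 2 * V * ‖g‖ := by
    calc ‖Dg‖ ≤ ‖linEst (P t) g‖ + ‖linEst (P u) g‖ := norm_sub_le _ _
      _ ≤ V * ‖g‖ + V * ‖g‖ := add_le_add (norm_linEst_le (hPV t) g) (norm_linEst_le (hPV u) g)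
      _ = 2 * V * ‖g‖ := by ring
  have ha : ‖g - γ • Dg‖ ≤ (1 + 2 * (γ * V)) * ‖g‖ := by
    calc ‖g - γ • Dg‖ ≤ ‖g‖ + ‖γ • Dg‖ := norm_sub_le _ _
      _ = ‖g‖ + γ * ‖Dg‖ := by rw [norm_smul, Real.norm_of_nonneg hγ0]
      _ ≤ ‖g‖ + γ * (2 * V * ‖g‖) := by gcongr
      _ = _ := by ring
  have ha2 : 2 * σ ^ 2 / (β - 4 * σ ^ 2 * V) * ‖g - γ • Dg‖ ^ 2 ≤ γ * ‖g‖ ^ 2 := by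
    calc 2 * σ ^ 2 / (β - 4 * σ ^ 2 * V) * ‖g - γ • Dg‖ ^ 2
        ≤ 2 * σ ^ 2 / (β - 4 * σ ^ 2 * V) * ((1 + 2 * (γ * V)) * ‖g‖) ^ 2 := by gcongr
      _ = 2 * σ ^ 2 * (1 + 2 * (γ * V)) ^ 2 / (β - 4 * σ ^ 2 * V) * ‖g‖ ^ 2 := by ring
      _ = γ * ‖g‖ ^ 2 := by rw [hγ, gam_quadratic hV hβ', mul_div_cancel_right₀ _ hd.ne']
  refine (lintegral_mono fun ω => ENNReal.ofReal_le_ofReal (Real.exp_le_exp.2 ?_)).trans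
    (hW.lintegral_exp_linEst_le (hP t) hV (hPV t) hβ (g - γ • Dg))
  rw [logExcess]
  refine mul_le_mul_of_nonneg_left ?_ (by positivity)
  set w := W ω
  have h1 := risk_sub_steinRisk σ (P t) f₀ w
  have h2 := risk_sub_steinRisk σ (P u) f₀ w
  have hu := inner_linEst_self_nonneg (hP u) w
  have hdiff : linEst (P t) (f₀ + w) - linEst (P u) (f₀ + w) =
      g + (linEst (P t) w - linEst (P u) w) := by
    rw [linEst_add, linEst_add, hg]; abel
  have hsymm : inner ℝ g (linEst (P t) w - linEst (P u) w) = inner ℝ Dg w := by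
    rw [inner_sub_right, ← inner_linEst_left (hP t).isHermitian,
      ← inner_linEst_left (hP u).isHermitian, ← inner_sub_left]
  have h3 : γ * (‖g‖ ^ 2 + 2 * inner ℝ Dg w) ≤
      γ * ‖linEst (P t) (f₀ + w) - linEst (P u) (f₀ + w)‖ ^ 2 := by
    rw [hdiff, norm_add_sq_real, hsymm]
    exact mul_le_mul_of_nonneg_left (le_add_of_nonneg_right (sq_nonneg _)) hγ0
  have hinner : inner ℝ (g - γ • Dg) w =
      inner ℝ (linEst (P t) f₀) w - inner ℝ (linEst (P u) f₀) w - γ * inner ℝ Dg w := by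
    rw [inner_sub_left, real_inner_smul_left, hg, inner_sub_left]
  rw [hinner, price]
  linarith [hpen t]

end LinearEstimates

/-! ### Change of measure -/

section ChangeOfMeasure

open InformationTheory

variable {T : Type*} [MeasurableSpace T]

theorem integrable_of_bounded {μ : Measure T} [IsFiniteMeasure μ] {f : T → ℝ}
    (hf : Measurable f) {C : ℝ} (hC : ∀ t, |f t| ≤ C) : Integrable f μ :=
  Integrable.of_bound hf.aestronglyMeasurable C (Filter.Eventually.of_forall hC)

theorem integrable_exp_of_le {μ : Measure T} [IsFiniteMeasure μ] {f : T → ℝ}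
    (hf : Measurable f) {C : ℝ} (hC : ∀ t, f t ≤ C) : Integrable (fun t => Real.exp (f t)) μ :=
  integrable_of_bounded (by fun_prop) (C := Real.exp C) fun t => by
    rw [abs_of_pos (Real.exp_pos _)]
    exact Real.exp_le_exp.2 (hC t)

/-- The Donsker-Varadhan inequality, which is the nonnegativity of the divergence of `μ` from
`ν.tilted f`. -/
theorem integral_le_toReal_klDiv_add_log {μ ν : Measure T} [IsProbabilityMeasure μ]
    [IsProbabilityMeasure ν] (hkl : klDiv μ ν ≠ ∞) {f : T → ℝ} (hfμ : Integrable f μ)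
    (hfν : Integrable (fun t => Real.exp (f t)) ν) :
    ∫ t, f t ∂μ ≤ (klDiv μ ν).toReal + Real.log (∫ t, Real.exp (f t) ∂ν) := by
  obtain ⟨hac, hint⟩ := klDiv_ne_top_iff.1 hkl
  have := isProbabilityMeasure_tilted hfν
  have h := integral_llr_add_sub_measure_univ_nonneg
    (hac.trans (absolutelyContinuous_tilted hfν)) (integrable_llr_tilted_right hac hfμ hint hfν)
  rw [integral_llr_tilted_right hac hfμ hfν hint] at h
  rw [toReal_klDiv hac hint]
  simp only [probReal_univ] at h ⊢
  linarith

theorem measurable_integral_fst {ρ : Measure T} [SFinite ρ] {F : T → T → ℝ}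
    (hF : Measurable (Function.uncurry F)) : Measurable fun u => ∫ t, F t u ∂ρ :=
  (hF.comp measurable_swap).stronglyMeasurable.integral_prod_right'.measurable

theorem abs_integral_le_of_abs_le {ρ : Measure T} [IsProbabilityMeasure ρ] {f : T → ℝ} {K : ℝ}
    (hf : ∀ t, |f t| ≤ K) : |∫ t, f t ∂ρ| ≤ K := by
  have h := norm_integral_le_of_norm_le_const (μ := ρ) (f := f) (C := K)
    (Filter.Eventually.of_forall hf)
  rwa [probReal_univ, mul_one] at h

theorem integral_add_integral_le_of_add_le {μ ρ : Measure T} [IsProbabilityMeasure μ]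
    [IsProbabilityMeasure ρ] {F : T → T → ℝ} (hF : Measurable (Function.uncurry F)) {K : ℝ}
    (hFK : ∀ t u, |F t u| ≤ K) {φ ψ : T → ℝ} (hφ : Integrable φ ρ) (hψ : Integrable ψ μ)
    (h : ∀ t u, φ t + ψ u ≤ F t u) :
    ∫ t, φ t ∂ρ + ∫ u, ψ u ∂μ ≤ ∫ u, ∫ t, F t u ∂ρ ∂μ := by
  have hinner : ∀ u, ∫ t, φ t ∂ρ + ψ u ≤ ∫ t, F t u ∂ρ := fun u => by
    calc ∫ t, φ t ∂ρ + ψ u = ∫ t, (φ t + ψ u) ∂ρ := by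
          rw [integral_add hφ (integrable_const _), integral_const, probReal_univ, one_smul]
      _ ≤ _ := integral_mono (hφ.add (integrable_const _))
          (integrable_of_bounded (hF.comp (measurable_id.prodMk measurable_const))
            fun t => hFK t u) fun t => h t u
  calc ∫ t, φ t ∂ρ + ∫ u, ψ u ∂μ = ∫ u, (∫ t, φ t ∂ρ + ψ u) ∂μ := by
        rw [integral_add (integrable_const _) hψ, integral_const, probReal_univ, one_smul]
    _ ≤ _ := integral_mono ((integrable_const _).add hψ)
        (integrable_of_bounded (measurable_integral_fst hF)
          fun u => abs_integral_le_of_abs_le fun t => hFK t u) hinner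

/-- A bound on the integral of `F` over the product of the Gibbs measure `ν.tilted g` and an
arbitrary `μ`. The Donsker-Varadhan inequality for `μ` is used twice: with `g`, which bounds the
normalizing constant of the Gibbs measure from below, and with the partial integral of `F`, whose
exponential Jensen's inequality bounds. The function `g` need not be bounded below. -/
theorem integral_integral_tilted_le {μ ν : Measure T} [IsProbabilityMeasure μ]
    [IsProbabilityMeasure ν] (hkl : klDiv μ ν ≠ ∞) {g : T → ℝ} (hg : Measurable g) {C : ℝ}
    (hgC : ∀ t, g t ≤ C) (hgμ : Integrable g μ) {F : T → T → ℝ}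
    (hF : Measurable (Function.uncurry F)) {K : ℝ} (hFK : ∀ t u, |F t u| ≤ K) {L : ℝ}
    (hL : ∫⁻ u, ∫⁻ t, ENNReal.ofReal (Real.exp (F t u + g t)) ∂ν ∂ν ≤
      ENNReal.ofReal (Real.exp L)) :
    ∫ u, ∫ t, F t u ∂(ν.tilted g) ∂μ ≤ -∫ t, g t ∂μ + 2 * (klDiv μ ν).toReal + L := by
  have hgν : Integrable (fun t => Real.exp (g t)) ν := integrable_exp_of_le hg hgC
  have := isProbabilityMeasure_tilted hgν
  have hFu : ∀ u, Measurable fun t => F t u := fun u =>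
    hF.comp (measurable_id.prodMk measurable_const)
  have hFub : ∀ u, Integrable (fun t => F t u) (ν.tilted g) := fun u =>
    integrable_of_bounded (hFu u) fun t => hFK t u
  set J : T → ℝ := fun u => ∫ t, F t u ∂(ν.tilted g) with hJ
  have hJm : Measurable J := measurable_integral_fst hF
  have hJK : ∀ u, |J u| ≤ K := fun u => abs_integral_le_of_abs_le fun t => hFK t u
  have hJexp : Integrable (fun u => Real.exp (J u)) ν :=
    integrable_exp_of_le hJm fun u => (le_abs_self _).trans (hJK u)
  set Z := ∫ t, Real.exp (g t) ∂ν with hZ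
  have hZpos : 0 < Z := integral_exp_pos hgν
  have hJpos : 0 < ∫ u, Real.exp (J u) ∂ν := integral_exp_pos hJexp
  have h1 := integral_le_toReal_klDiv_add_log hkl hgμ hgν
  have h2 := integral_le_toReal_klDiv_add_log hkl (integrable_of_bounded hJm hJK) hJexp
  have hjensen : ∀ u, ENNReal.ofReal (Z * Real.exp (J u)) ≤
      ∫⁻ t, ENNReal.ofReal (Real.exp (F t u + g t)) ∂ν := by
    intro u
    have h : Real.exp (J u) ≤ ∫ t, Real.exp (F t u) ∂(ν.tilted g) :=
      ConvexOn.map_integral_le (μ := ν.tilted g) convexOn_exp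
        Real.continuous_exp.continuousOn isClosed_univ
        (Filter.Eventually.of_forall fun _ => Set.mem_univ _) (hFub u)
        (integrable_exp_of_le (hFu u) fun t => (le_abs_self _).trans (hFK t u))
    rw [integral_exp_tilted g fun t => F t u, le_div_iff₀ hZpos, mul_comm] at h
    simp only [Pi.add_apply, add_comm (g _)] at h
    rw [← ofReal_integral_eq_lintegral_ofReal
      (integrable_exp_of_le (f := fun t => F t u + g t) ((hFu u).add hg) fun t =>
        add_le_add ((le_abs_self _).trans (hFK t u)) (hgC t))
      (Filter.Eventually.of_forall fun _ => (Real.exp_pos _).le)]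
    exact ENNReal.ofReal_le_ofReal h
  have h3 : Z * ∫ u, Real.exp (J u) ∂ν ≤ Real.exp L := by
    rw [← ENNReal.ofReal_le_ofReal_iff (Real.exp_pos _).le, ← integral_const_mul,
      ofReal_integral_eq_lintegral_ofReal (hJexp.const_mul _)
        (Filter.Eventually.of_forall fun _ => mul_nonneg hZpos.le (Real.exp_pos _).le)]
    exact (lintegral_mono hjensen).trans hL
  have h4 := (Real.log_le_iff_le_exp (mul_pos hZpos hJpos)).2 h3
  rw [Real.log_mul hZpos.ne' hJpos.ne'] at h4
  linarith

end ChangeOfMeasure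

/-! ### The averaged exponential moment of the excess -/

section OracleInequality

open InformationTheory

variable {n : ℕ} {T : Type*} [MeasurableSpace T]

theorem measurable_linEst {X : Type*} [MeasurableSpace X] {Q : X → Matrix (Fin n) (Fin n) ℝ}
    (hQ : ∀ i j, Measurable fun x => Q x i j) {Y : X → EuclideanSpace ℝ (Fin n)}
    (hY : Measurable Y) : Measurable fun x => linEst (Q x) (Y x) := by
  refine (MeasurableEquiv.toLp 2 (Fin n → ℝ)).measurable.comp
    (f := fun x => Matrix.mulVec (Q x) (Y x).ofLp) (measurable_pi_lambda _ fun i => ?_)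
  simp only [Matrix.mulVec, dotProduct]
  fun_prop

theorem measurable_trace {X : Type*} [MeasurableSpace X] {Q : X → Matrix (Fin n) (Fin n) ℝ}
    (hQ : ∀ i j, Measurable fun x => Q x i j) : Measurable fun x => (Q x).trace :=
  Finset.measurable_sum _ fun i _ => hQ i i

theorem measurable_steinRisk {X : Type*} [MeasurableSpace X] (σ : ℝ)
    {Q : X → Matrix (Fin n) (Fin n) ℝ}
    (hQ : ∀ i j, Measurable fun x => Q x i j) {Y : X → EuclideanSpace ℝ (Fin n)}
    (hY : Measurable Y) : Measurable fun x => steinRisk σ (Q x) (Y x) :=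
  (((hY.sub (measurable_linEst hQ hY)).norm.pow_const 2).add
    ((measurable_trace hQ).const_mul _)).sub_const _

theorem measurable_logExcess {X : Type*} [MeasurableSpace X] (σ V β : ℝ)
    {P : T → Matrix (Fin n) (Fin n) ℝ} (hP : ∀ i j, Measurable fun t => P t i j)
    {pen : T → ℝ} (hpen : Measurable pen) (f₀ : EuclideanSpace ℝ (Fin n))
    {Y : X → EuclideanSpace ℝ (Fin n)} (hY : Measurable Y) {t u : X → T} (ht : Measurable t)
    (hu : Measurable u) : Measurable fun x => logExcess σ V β P pen f₀ (Y x) (t x) (u x) := by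
  have ht' : ∀ i j, Measurable fun x => P (t x) i j := fun i j => (hP i j).comp ht
  have hu' : ∀ i j, Measurable fun x => P (u x) i j := fun i j => (hP i j).comp hu
  have h1 := measurable_linEst ht' hY
  have h2 := measurable_linEst hu' hY
  have h3 := measurable_steinRisk σ ht' hY
  have h4 := measurable_steinRisk σ hu' hY
  have h5 := measurable_trace hu'
  have h6 := hpen.comp ht
  simp only [Function.comp_def] at h6
  simp only [logExcess, price]
  fun_prop

/-- The exponential moment of the excess, averaged over both arguments with respect to the prior, as
a function of the observation `Y`. It takes values in `[0, ∞]`. -/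
noncomputable def excessMoment (σ V β : ℝ) (P : T → Matrix (Fin n) (Fin n) ℝ) (pen : T → ℝ)
    (prior : Measure T) (f₀ Y : EuclideanSpace ℝ (Fin n)) : ℝ≥0∞ :=
  ∫⁻ u, ∫⁻ t, ENNReal.ofReal (Real.exp (logExcess σ V β P pen f₀ Y t u)) ∂prior ∂prior

theorem measurable_excessMoment {Ω : Type*} [MeasurableSpace Ω] (σ V β : ℝ)
    {P : T → Matrix (Fin n) (Fin n) ℝ} (hP : ∀ i j, Measurable fun t => P t i j)
    {pen : T → ℝ} (hpen : Measurable pen) (prior : Measure T) [SFinite prior]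
    (f₀ : EuclideanSpace ℝ (Fin n)) {Y : Ω → EuclideanSpace ℝ (Fin n)} (hY : Measurable Y) :
    Measurable fun ω => excessMoment σ V β P pen prior f₀ (Y ω) := by
  refine Measurable.lintegral_prod_right' (f := fun p : Ω × T =>
    ∫⁻ t, ENNReal.ofReal (Real.exp (logExcess σ V β P pen f₀ (Y p.1) t p.2)) ∂prior) ?_
  refine Measurable.lintegral_prod_right' (f := fun q : (Ω × T) × T =>
    ENNReal.ofReal (Real.exp (logExcess σ V β P pen f₀ (Y q.1.1) q.2 q.1.2))) ?_
  have := measurable_logExcess σ V β hP hpen f₀ (hY.comp (measurable_fst.comp measurable_fst))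
    (t := fun q : (Ω × T) × T => q.2) (u := fun q => q.1.2) (by fun_prop) (by fun_prop)
  exact ENNReal.measurable_ofReal.comp (Real.measurable_exp.comp this)

theorem IsCenteredSubGaussian.lintegral_excessMoment_le {Ω : Type*} [MeasurableSpace Ω]
    {W : Ω → EuclideanSpace ℝ (Fin n)} {σ : ℝ}
    {Pr : Measure Ω} [IsProbabilityMeasure Pr] (hW : IsCenteredSubGaussian W σ Pr)
    {P : T → Matrix (Fin n) (Fin n) ℝ} (hPmeas : ∀ i j, Measurable fun t => P t i j)
    (hP : ∀ t, (P t).PosSemidef) {V β : ℝ}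
    (hV : 0 < V) (hPV : ∀ t, ‖Matrix.toEuclideanCLM (𝕜 := ℝ) (P t)‖ ≤ V)
    (hβ : 4 * σ ^ 2 * V < β) (hβ' : 20 * σ ^ 2 * V ≤ β) {pen : T → ℝ} (hpenmeas : Measurable pen)
    (hpen : ∀ t, 4 * σ ^ 4 / (β - 4 * σ ^ 2 * V) * (P t ^ 2).trace ≤ pen t)
    (prior : Measure T) [IsProbabilityMeasure prior] (f₀ : EuclideanSpace ℝ (Fin n)) :
    ∫⁻ ω, excessMoment σ V β P pen prior f₀ (f₀ + W ω) ∂Pr ≤ 1 := by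
  have hY : Measurable fun ω => f₀ + W ω := hW.measurable.const_add f₀
  have hm : Measurable fun q : (Ω × T) × T => ENNReal.ofReal
      (Real.exp (logExcess σ V β P pen f₀ (f₀ + W q.1.1) q.2 q.1.2)) :=
    ENNReal.measurable_ofReal.comp (Real.measurable_exp.comp
      (measurable_logExcess σ V β hPmeas hpenmeas f₀
        (hY.comp (measurable_fst.comp measurable_fst)) measurable_snd
        (measurable_snd.comp measurable_fst)))
  simp only [excessMoment]
  rw [lintegral_lintegral_swap (f := fun ω u => ∫⁻ t, ENNReal.ofReal
    (Real.exp (logExcess σ V β P pen f₀ (f₀ + W ω) t u)) ∂prior)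
    hm.lintegral_prod_right'.aemeasurable]
  have : ∀ u, ∫⁻ ω, ∫⁻ t, ENNReal.ofReal
      (Real.exp (logExcess σ V β P pen f₀ (f₀ + W ω) t u)) ∂prior ∂Pr ≤ 1 := by
    intro u
    rw [lintegral_lintegral_swap (f := fun ω t => ENNReal.ofReal
      (Real.exp (logExcess σ V β P pen f₀ (f₀ + W ω) t u)))
      (hm.comp ((measurable_fst.prodMk measurable_const).prodMk measurable_snd)).aemeasurable]
    calc _ ≤ ∫⁻ _, 1 ∂prior := lintegral_mono fun t =>
          hW.lintegral_exp_logExcess_le hP hV hPV hβ hβ' hpen f₀ t u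
      _ = 1 := by simp
  calc _ ≤ ∫⁻ _, 1 ∂prior := lintegral_mono this
    _ = 1 := by simp

/-! ### The oracle inequality for a given observation -/

theorem normSq_sub_add_le {E : Type*} [NormedAddCommGroup E] [InnerProductSpace ℝ E] (x y z : E)
    {ν : ℝ} (hν : 0 < ν) :
    ‖y - z‖ ^ 2 ≤ (1 + ν) * ‖x - y‖ ^ 2 + (1 + 1 / ν) * ‖x - z‖ ^ 2 := by
  have h1 : ‖y - z‖ ≤ ‖x - y‖ + ‖x - z‖ := by
    rw [norm_sub_rev x y]; exact norm_sub_le_norm_sub_add_norm_sub y x z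
  have h2 : 0 ≤ (ν * ‖x - y‖ - ‖x - z‖) ^ 2 / ν := by positivity
  calc ‖y - z‖ ^ 2 ≤ (‖x - y‖ + ‖x - z‖) ^ 2 := by gcongr
    _ ≤ (‖x - y‖ + ‖x - z‖) ^ 2 + (ν * ‖x - y‖ - ‖x - z‖) ^ 2 / ν := by linarith
    _ = _ := by field_simp; ring

/-- Jensen's inequality for the squared distance to `x`. -/
theorem normSq_sub_integral_le {E : Type*} [NormedAddCommGroup E] [InnerProductSpace ℝ E]
    [CompleteSpace E] {ρ : Measure T} [IsProbabilityMeasure ρ] {f : T → E} (x : E)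
    (hf : Integrable f ρ) (hf2 : Integrable (fun t => ‖x - f t‖ ^ 2) ρ) :
    ‖x - ∫ t, f t ∂ρ‖ ^ 2 ≤ ∫ t, ‖x - f t‖ ^ 2 ∂ρ := by
  have hconv : ConvexOn ℝ Set.univ fun y : E => ‖y‖ ^ 2 :=
    convexOn_univ_norm.pow (fun _ _ => norm_nonneg _) 2
  have h := hconv.map_integral_le (μ := ρ) (f := fun t => x - f t) (by fun_prop) isClosed_univ
    (Filter.Eventually.of_forall fun _ => Set.mem_univ _) ((integrable_const x).sub hf) hf2
  rwa [integral_sub (integrable_const x) hf, integral_const, probReal_univ, one_smul] at h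

theorem one_add_eps {γ ν : ℝ} (hν : ν ≠ 0) (h : 1 - (1 + ν) * γ ≠ 0) :
    1 + eps γ ν = (1 + (1 + 1 / ν) * γ) / (1 - (1 + ν) * γ) := by
  rw [eps, eq_div_iff h, add_mul, one_mul, div_mul_eq_mul_div, mul_div_mul_right _ _ h]
  field_simp
  ring

/-- The oracle inequality for a fixed observation `Y`, with `L` a bound on the logarithm of the
averaged exponential moment. No distribution of `Y` is involved. -/
theorem normSq_sub_aggregate_le
    {P : T → Matrix (Fin n) (Fin n) ℝ} (hPmeas : ∀ i j, Measurable fun t => P t i j)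
    (hP : ∀ t, (P t).PosSemidef) {σ V β : ℝ}
    (hV : 0 < V) (hPV : ∀ t, ‖Matrix.toEuclideanCLM (𝕜 := ℝ) (P t)‖ ≤ V)
    (hβ0 : 0 < β) (hβ' : 20 * σ ^ 2 * V ≤ β) {pen : T → ℝ} (hpenmeas : Measurable pen)
    (hpen : ∀ t, 0 ≤ pen t)
    {prior : Measure T} [IsProbabilityMeasure prior] (f₀ Y : EuclideanSpace ℝ (Fin n)) {L : ℝ}
    (hL : excessMoment σ V β P pen prior f₀ Y ≤ ENNReal.ofReal (Real.exp L))
    {ν : ℝ} (hν : ν ∈ admissible (gam σ V β)) {μ : Measure T} [IsProbabilityMeasure μ]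
    (hkl : klDiv μ prior ≠ ∞) (hint : Integrable (fun t => pen t + price σ (P t)) μ) :
    ‖f₀ - aggregate σ β P pen prior Y‖ ^ 2 ≤
      (1 + eps (gam σ V β) ν) * ∫ t, ‖f₀ - linEst (P t) Y‖ ^ 2 ∂μ
        + (1 + eps' (gam σ V β) ν) * ∫ t, pen t + price σ (P t) ∂μ
        + β * (1 + eps' (gam σ V β) ν) * (2 * (klDiv μ prior).toReal + L) := by
  obtain ⟨hν0, hν1⟩ := hν
  set γ := gam σ V β with hγ
  have hγ0 : 0 ≤ γ := gam_nonneg hV hβ'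
  have hc : 0 < 1 - (1 + ν) * γ := by linarith
  have hf : Measurable fun t => linEst (P t) Y := measurable_linEst hPmeas measurable_const
  have hfb : ∀ t, ‖linEst (P t) Y‖ ≤ V * ‖Y‖ := fun t => norm_linEst_le (hPV t) Y
  have hbd : ∀ {x y : EuclideanSpace ℝ (Fin n)} {a b : ℝ}, ‖x‖ ≤ a → ‖y‖ ≤ b →
      |‖x - y‖ ^ 2| ≤ (a + b) ^ 2 := fun hx hy => by
    rw [abs_of_nonneg (sq_nonneg _)]
    have := norm_sub_le_of_le hx hy
    gcongr
  set R : T → ℝ := fun t => ‖f₀ - linEst (P t) Y‖ ^ 2 with hR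
  set S : T → ℝ := fun t => ‖Y - linEst (P t) Y‖ ^ 2 - n * σ ^ 2 with hS
  have hRm : Measurable R := by fun_prop
  have hRb : ∀ t, |R t| ≤ (‖f₀‖ + V * ‖Y‖) ^ 2 := fun t => hbd le_rfl (hfb t)
  have hSm : Measurable S := by fun_prop
  have hSb : ∀ t, |S t| ≤ (‖Y‖ + V * ‖Y‖) ^ 2 + |n * σ ^ 2| := fun t =>
    (abs_sub _ _).trans (add_le_add_left (hbd le_rfl (hfb t)) _)
  set g : T → ℝ := fun t => -(1 / β) * (steinRisk σ (P t) Y + pen t) with hg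
  have hgm : Measurable g :=
    ((measurable_steinRisk σ hPmeas measurable_const).add hpenmeas).const_mul _
  have hgS : ∀ t, g t = -(1 / β) * (S t + (pen t + price σ (P t))) := fun t => by
    simp only [hg, hS, steinRisk, price]; ring
  have hgb : ∀ t, g t ≤ 1 / β * (n * σ ^ 2) := by
    intro t
    have h1 : 0 ≤ price σ (P t) := mul_nonneg (by positivity) (hP t).trace_nonneg
    have h2 := hpen t
    have h3 := sq_nonneg ‖Y - linEst (P t) Y‖
    rw [hgS, neg_mul, ← mul_neg]
    refine mul_le_mul_of_nonneg_left ?_ (by positivity)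
    simp only [hS]
    linarith
  have hgμ : Integrable g μ := by
    simp only [funext hgS]
    exact ((integrable_of_bounded hSm hSb).add hint).const_mul _
  -- The excess is `F t u + g t`, where the weights have density proportional to `exp g`: the
  -- penalty at `t` is in `g` only, so `F` is bounded although `pen` need not be.
  set F : T → T → ℝ := fun t u =>
    1 / β * (R t - R u + S u - γ * ‖linEst (P t) Y - linEst (P u) Y‖ ^ 2) with hF
  have hFm : Measurable (Function.uncurry F) := by
    simp only [hF, Function.uncurry_def]
    have h1 : Measurable fun p : T × T => linEst (P p.1) Y := hf.comp measurable_fst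
    have h2 : Measurable fun p : T × T => linEst (P p.2) Y := hf.comp measurable_snd
    fun_prop
  obtain ⟨K, hFK⟩ : ∃ K, ∀ t u, |F t u| ≤ K := by
    -- The sum of the bounds on the four terms of `F`.
    refine ⟨1 / β * ((‖f₀‖ + V * ‖Y‖) ^ 2 + (‖f₀‖ + V * ‖Y‖) ^ 2 +
      ((‖Y‖ + V * ‖Y‖) ^ 2 + |n * σ ^ 2|) + γ * (V * ‖Y‖ + V * ‖Y‖) ^ 2), fun t u => ?_⟩
    rw [hF, abs_mul, abs_of_pos (by positivity : 0 < 1 / β)]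
    refine mul_le_mul_of_nonneg_left ?_ (by positivity)
    refine (abs_sub _ _).trans (add_le_add ((abs_add_le _ _).trans (add_le_add
      ((abs_sub _ _).trans (add_le_add (hRb t) (hRb u))) (hSb u))) ?_)
    rw [abs_mul, abs_of_nonneg hγ0]
    exact mul_le_mul_of_nonneg_left (hbd (hfb t) (hfb u)) hγ0
  have hFg : ∀ t u, logExcess σ V β P pen f₀ Y t u = F t u + g t := by
    intro t u
    simp only [logExcess, hF, hg, hR, hS, steinRisk, price]
    ring
  simp only [excessMoment, hFg] at hL
  have hmain := integral_integral_tilted_le hkl hgm hgb hgμ hFm hFK hL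
  have hρ : IsProbabilityMeasure (prior.tilted g) :=
    isProbabilityMeasure_tilted (integrable_exp_of_le hgm hgb)
  have hRi : ∀ (m : Measure T) [IsProbabilityMeasure m], Integrable R m :=
    fun m _ => integrable_of_bounded hRm hRb
  have hSi : Integrable S μ := integrable_of_bounded hSm hSb
  have hlower := integral_add_integral_le_of_add_le (ρ := prior.tilted g) hFm hFK
    (φ := fun t => 1 / β * ((1 - (1 + ν) * γ) * R t))
    (ψ := fun u => 1 / β * (S u - (1 + (1 + 1 / ν) * γ) * R u))
    (((hRi _).const_mul _).const_mul _) ((hSi.sub ((hRi μ).const_mul _)).const_mul _) (by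
      intro t u
      simp only [hF, ← mul_add]
      refine mul_le_mul_of_nonneg_left ?_ (by positivity)
      have := mul_le_mul_of_nonneg_left
        (normSq_sub_add_le f₀ (linEst (P t) Y) (linEst (P u) Y) hν0) hγ0
      simp only [hR]
      linarith)
  rw [integral_const_mul, integral_const_mul, integral_const_mul,
    integral_sub hSi ((hRi μ).const_mul _), integral_const_mul] at hlower
  have hgint : ∫ t, g t ∂μ = -(1 / β) * (∫ t, S t ∂μ + ∫ t, pen t + price σ (P t) ∂μ) := by
    simp only [funext hgS]
    rw [integral_const_mul, integral_add hSi hint]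
  have hbound := hlower.trans hmain
  rw [hgint] at hbound
  have hagg : ‖f₀ - aggregate σ β P pen prior Y‖ ^ 2 ≤ ∫ t, R t ∂(prior.tilted g) :=
    normSq_sub_integral_le (ρ := prior.tilted g) f₀
      (Integrable.of_bound hf.aestronglyMeasurable _ (Filter.Eventually.of_forall hfb)) (hRi _)
  refine hagg.trans ?_
  set IR := ∫ t, R t ∂(prior.tilted g)
  set IRμ := ∫ t, R t ∂μ
  set ISμ := ∫ t, S t ∂μ
  set Ip := ∫ t, pen t + price σ (P t) ∂μ
  set kl := (klDiv μ prior).toReal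
  have hb2 := mul_le_mul_of_nonneg_left hbound hβ0.le
  have e1 : β * (1 / β * ((1 - (1 + ν) * γ) * IR) +
      1 / β * (ISμ - (1 + (1 + 1 / ν) * γ) * IRμ)) =
      (1 - (1 + ν) * γ) * IR + (ISμ - (1 + (1 + 1 / ν) * γ) * IRμ) := by field_simp
  have e2 : β * (-(-(1 / β) * (ISμ + Ip)) + 2 * kl + L) = ISμ + Ip + β * (2 * kl + L) := by
    field_simp
    ring
  rw [e1, e2] at hb2
  have hle : IR ≤ ((1 + (1 + 1 / ν) * γ) * IRμ + Ip + β * (2 * kl + L)) /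
      (1 - (1 + ν) * γ) := by
    rw [le_div_iff₀ hc]
    linarith
  refine hle.trans_eq ?_
  rw [one_add_eps hν0.ne' hc.ne', eps']
  ring

theorem eps'_nonneg {γ ν : ℝ} (hγ : 0 ≤ γ) (hν : ν ∈ admissible γ) : 0 ≤ eps' γ ν := by
  obtain ⟨hν0, hν1⟩ := hν
  rw [eps', sub_nonneg]
  exact (one_le_div (by linarith)).2 (by nlinarith)

theorem eps_nonneg {γ ν : ℝ} (hγ : 0 ≤ γ) (hν : ν ∈ admissible γ) : 0 ≤ eps γ ν := by
  obtain ⟨hν0, hν1⟩ := hν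
  have : 0 < 1 - (1 + ν) * γ := by linarith
  rw [eps]
  positivity

/-- The oracle inequality for a fixed observation, in `[0, ∞]` and without finiteness assumptions.
The logarithm of the averaged exponential moment is bounded by a difference `L₁ - L₂` of nonnegative
numbers, and `L₂` is moved to the left because `[0, ∞]` has no subtraction. -/
theorem ofReal_normSq_sub_aggregate_add_le
    {P : T → Matrix (Fin n) (Fin n) ℝ} (hPmeas : ∀ i j, Measurable fun t => P t i j)
    (hP : ∀ t, (P t).PosSemidef) {σ V β : ℝ}
    (hV : 0 < V) (hPV : ∀ t, ‖Matrix.toEuclideanCLM (𝕜 := ℝ) (P t)‖ ≤ V)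
    (hβ0 : 0 < β) (hβ' : 20 * σ ^ 2 * V ≤ β) {pen : T → ℝ} (hpenmeas : Measurable pen)
    (hpen : ∀ t, 0 ≤ pen t)
    {prior : Measure T} [IsProbabilityMeasure prior] (f₀ Y : EuclideanSpace ℝ (Fin n))
    {L₁ L₂ : ℝ} (hL₁ : 0 ≤ L₁) (hL₂ : 0 ≤ L₂)
    (hL : excessMoment σ V β P pen prior f₀ Y ≤ ENNReal.ofReal (Real.exp (L₁ - L₂)))
    {ν : ℝ} (hν : ν ∈ admissible (gam σ V β)) (μ : Measure T) [IsProbabilityMeasure μ] :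
    ENNReal.ofReal (‖f₀ - aggregate σ β P pen prior Y‖ ^ 2)
        + ENNReal.ofReal (β * (1 + eps' (gam σ V β) ν)) * ENNReal.ofReal L₂ ≤
      ENNReal.ofReal (1 + eps (gam σ V β) ν) *
          ∫⁻ t, ENNReal.ofReal (‖f₀ - linEst (P t) Y‖ ^ 2) ∂μ
        + ENNReal.ofReal (1 + eps' (gam σ V β) ν) *
          ∫⁻ t, ENNReal.ofReal (pen t + price σ (P t)) ∂μ
        + ENNReal.ofReal (β * (1 + eps' (gam σ V β) ν)) *
          (2 * InformationTheory.klDiv μ prior + ENNReal.ofReal L₁) := by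
  have hγ0 : 0 ≤ gam σ V β := gam_nonneg hV hβ'
  have he' := eps'_nonneg hγ0 hν
  have he := eps_nonneg hγ0 hν
  have hb : 0 < β * (1 + eps' (gam σ V β) ν) := by positivity
  have hprice : ∀ t, 0 ≤ pen t + price σ (P t) := fun t =>
    add_nonneg (hpen t) (mul_nonneg (by positivity) (hP t).trace_nonneg)
  -- The right-hand side is `∞` unless both the divergence and the penalty integral are finite.
  by_cases hkl : InformationTheory.klDiv μ prior = ∞
  · rw [hkl, ENNReal.mul_top two_ne_zero, top_add, ENNReal.mul_top (by simpa using hb), add_top]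
    exact le_top
  by_cases hpp : ∫⁻ t, ENNReal.ofReal (pen t + price σ (P t)) ∂μ = ∞
  · rw [hpp, ENNReal.mul_top (by simpa using (by positivity : 0 < 1 + eps' (gam σ V β) ν)),
      add_top, top_add]
    exact le_top
  have hpm : Measurable fun t => pen t + price σ (P t) :=
    hpenmeas.add ((measurable_trace hPmeas).const_mul _)
  have hint : Integrable (fun t => pen t + price σ (P t)) μ :=
    (lintegral_ofReal_ne_top_iff_integrable hpm.aestronglyMeasurable
      (Filter.Eventually.of_forall hprice)).1 hpp
  have hRint : Integrable (fun t => ‖f₀ - linEst (P t) Y‖ ^ 2) μ := by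
    refine integrable_of_bounded
      (((measurable_linEst hPmeas measurable_const).const_sub f₀).norm.pow_const 2)
      (C := (‖f₀‖ + V * ‖Y‖) ^ 2) fun t => ?_
    rw [abs_of_nonneg (sq_nonneg _)]
    have := norm_sub_le_of_le (le_refl ‖f₀‖) (norm_linEst_le (hPV t) Y)
    gcongr
  have h := normSq_sub_aggregate_le hPmeas hP hV hPV hβ0 hβ' hpenmeas hpen f₀ Y hL hν hkl hint
  have hkl2 : 2 * InformationTheory.klDiv μ prior =
      ENNReal.ofReal (2 * (InformationTheory.klDiv μ prior).toReal) := by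
    rw [ENNReal.ofReal_mul zero_le_two, ENNReal.ofReal_toReal hkl, ENNReal.ofReal_ofNat]
  have hk0 : 0 ≤ 2 * (InformationTheory.klDiv μ prior).toReal := by positivity
  have hR0 : 0 ≤ ∫ t, ‖f₀ - linEst (P t) Y‖ ^ 2 ∂μ := integral_nonneg fun _ => sq_nonneg _
  have hI0 : 0 ≤ ∫ t, pen t + price σ (P t) ∂μ := integral_nonneg hprice
  rw [← ofReal_integral_eq_lintegral_ofReal hRint
      (Filter.Eventually.of_forall fun _ => sq_nonneg _),
    ← ofReal_integral_eq_lintegral_ofReal hint (Filter.Eventually.of_forall hprice),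
    hkl2, ← ENNReal.ofReal_add hk0 hL₁,
    ← ENNReal.ofReal_mul (by positivity), ← ENNReal.ofReal_mul (by positivity),
    ← ENNReal.ofReal_mul (by positivity), ← ENNReal.ofReal_mul (by positivity),
    ← ENNReal.ofReal_add (by positivity) (by positivity),
    ← ENNReal.ofReal_add (by positivity) (by positivity),
    ← ENNReal.ofReal_add (by positivity) (by positivity)]
  refine ENNReal.ofReal_le_ofReal ?_
  linarith
end OracleInequality

end EWA

/-! ### The oracle inequalities in probability and in expectation -/

theorem mainTheorem3 {n : ℕ} {Ω T : Type*} [MeasurableSpace Ω] [MeasurableSpace T]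
    (Pr : Measure Ω) [IsProbabilityMeasure Pr]
    (f₀ : EuclideanSpace ℝ (Fin n)) (W : Ω → EuclideanSpace ℝ (Fin n))
    (σ : ℝ) (hσ : 0 ≤ σ) (hW : EWA.IsCenteredSubGaussian W σ Pr)
    (P : T → Matrix (Fin n) (Fin n) ℝ) (hPmeas : ∀ i j, Measurable fun t => P t i j)
    (hPpos : ∀ t, (P t).PosSemidef)
    (V : ℝ) (hV : 0 < V) (hPV : ∀ t, ‖Matrix.toEuclideanCLM (𝕜 := ℝ) (P t)‖ ≤ V)
    (prior : Measure T) [IsProbabilityMeasure prior]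
    (β : ℝ) (hβ : 4 * σ ^ 2 * V < β) (hβ' : 20 * σ ^ 2 * V ≤ β)
    (pen : T → ℝ) (hpenmeas : Measurable pen)
    (hpen : ∀ t, 4 * σ ^ 4 / (β - 4 * σ ^ 2 * V) * (P t ^ 2).trace ≤ pen t) :
    -- the oracle inequality in probability
    (∀ η : ℝ, 0 < η → η ≤ 1 →
      ∃ A : Set Ω, MeasurableSet A ∧ ENNReal.ofReal (1 - η) ≤ Pr A ∧ ∀ ω ∈ A,
        ENNReal.ofReal (‖f₀ - EWA.aggregate σ β P pen prior (f₀ + W ω)‖ ^ 2) ≤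
          ⨅ ν ∈ EWA.admissible (EWA.gam σ V β), ⨅ μ : ProbabilityMeasure T,
            ENNReal.ofReal (1 + EWA.eps (EWA.gam σ V β) ν) *
                ∫⁻ t, ENNReal.ofReal (‖f₀ - EWA.linEst (P t) (f₀ + W ω)‖ ^ 2) ∂(μ : Measure T)
              + ENNReal.ofReal (1 + EWA.eps' (EWA.gam σ V β) ν) *
                ∫⁻ t, ENNReal.ofReal (pen t + EWA.price σ (P t)) ∂(μ : Measure T)
              + ENNReal.ofReal (β * (1 + EWA.eps' (EWA.gam σ V β) ν)) *
                (2 * InformationTheory.klDiv (μ : Measure T) prior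
                  + ENNReal.ofReal (Real.log (1 / η)))) ∧
    -- the oracle inequality in expectation
    ∫⁻ ω, ENNReal.ofReal (‖f₀ - EWA.aggregate σ β P pen prior (f₀ + W ω)‖ ^ 2) ∂Pr ≤
      ⨅ ν ∈ EWA.admissible (EWA.gam σ V β), ⨅ μ : ProbabilityMeasure T,
        ENNReal.ofReal (1 + EWA.eps (EWA.gam σ V β) ν) *
            ∫⁻ t, (∫⁻ ω, ENNReal.ofReal (‖f₀ - EWA.linEst (P t) (f₀ + W ω)‖ ^ 2) ∂Pr) ∂(μ : Measure T)
          + ENNReal.ofReal (1 + EWA.eps' (EWA.gam σ V β) ν) *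
            ∫⁻ t, ENNReal.ofReal (pen t + EWA.price σ (P t)) ∂(μ : Measure T)
          + ENNReal.ofReal (2 * β * (1 + EWA.eps' (EWA.gam σ V β) ν)) *
            InformationTheory.klDiv (μ : Measure T) prior := by
  have hβ0 : 0 < β := lt_of_le_of_lt (by positivity) hβ
  have hpen0 : ∀ t, 0 ≤ pen t := fun t => le_trans
    (mul_nonneg (div_nonneg (by positivity) (by linarith))
      (EWA.trace_sq_nonneg (hPpos t).isHermitian)) (hpen t)
  have hY : Measurable fun ω => f₀ + W ω := hW.measurable.const_add f₀
  set M : Ω → ℝ≥0∞ := fun ω => EWA.excessMoment σ V β P pen prior f₀ (f₀ + W ω) with hM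
  have hMm : Measurable M := EWA.measurable_excessMoment σ V β hPmeas hpenmeas prior f₀ hY
  have hM1 : ∫⁻ ω, M ω ∂Pr ≤ 1 :=
    hW.lintegral_excessMoment_le hPmeas hPpos hV hPV hβ hβ' hpenmeas hpen prior f₀
  refine ⟨fun η hη hη1 => ?_, ?_⟩
  · -- The event does not depend on `ν` and `μ`, so the infima can be taken inside it.
    have hA : MeasurableSet {ω | M ω < ENNReal.ofReal (1 / η)} :=
      measurableSet_lt hMm measurable_const
    refine ⟨_, hA, ?_, fun ω hω => ?_⟩
    · have hη' : 0 < 1 / η := by positivity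
      have hmarkov : Pr {ω | M ω < ENNReal.ofReal (1 / η)}ᶜ ≤ ENNReal.ofReal η := by
        have hc : {ω | M ω < ENNReal.ofReal (1 / η)}ᶜ = {ω | ENNReal.ofReal (1 / η) ≤ M ω} := by
          ext ω; simp
        rw [hc]
        refine (meas_ge_le_lintegral_div hMm.aemeasurable (by simpa using hη)
          ENNReal.ofReal_ne_top).trans ?_
        rw [one_div, ENNReal.ofReal_inv_of_pos hη, div_eq_mul_inv, inv_inv]
        exact mul_le_of_le_one_left zero_le hM1
      rw [ENNReal.ofReal_sub _ hη.le, ENNReal.ofReal_one, tsub_le_iff_right,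
        ← prob_add_prob_compl (μ := Pr) hA]
      gcongr
    · refine le_iInf₂ fun ν hν => le_iInf fun μ => ?_
      have h := EWA.ofReal_normSq_sub_aggregate_add_le hPmeas hPpos hV hPV hβ0 hβ' hpenmeas hpen0
        f₀ (f₀ + W ω) (L₁ := Real.log (1 / η)) (L₂ := 0)
        (Real.log_nonneg (by rw [le_div_iff₀ hη]; linarith)) le_rfl
        (by rw [sub_zero, Real.exp_log (by positivity)]; exact le_of_lt hω) hν (μ : Measure T)
      simpa using h
  · refine le_iInf₂ fun ν hν => le_iInf fun μ => ?_
    set b := ENNReal.ofReal (β * (1 + EWA.eps' (EWA.gam σ V β) ν)) with hb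
    have hpt : ∀ ω, ENNReal.ofReal (‖f₀ - EWA.aggregate σ β P pen prior (f₀ + W ω)‖ ^ 2) + b ≤
        ENNReal.ofReal (1 + EWA.eps (EWA.gam σ V β) ν) *
          ∫⁻ t, ENNReal.ofReal (‖f₀ - EWA.linEst (P t) (f₀ + W ω)‖ ^ 2) ∂(μ : Measure T)
        + ENNReal.ofReal (1 + EWA.eps' (EWA.gam σ V β) ν) *
          ∫⁻ t, ENNReal.ofReal (pen t + EWA.price σ (P t)) ∂(μ : Measure T)
        + b * (2 * InformationTheory.klDiv (μ : Measure T) prior + M ω) := by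
      intro ω
      have hbpos : 0 < β * (1 + EWA.eps' (EWA.gam σ V β) ν) := by
        have := EWA.eps'_nonneg (EWA.gam_nonneg hV hβ') hν
        positivity
      by_cases hMtop : M ω = ∞
      · rw [hMtop, add_top, ENNReal.mul_top (by simpa [hb] using hbpos), add_top]
        exact le_top
      -- The inequality `log x ≤ x - 1`, in the form `x ≤ exp (x - 1)`, replaces the logarithm of
      -- the averaged moment by the moment itself, whose expectation is known.
      have h := EWA.ofReal_normSq_sub_aggregate_add_le hPmeas hPpos hV hPV hβ0 hβ' hpenmeas hpen0
        f₀ (f₀ + W ω) (L₁ := (M ω).toReal) (L₂ := 1) ENNReal.toReal_nonneg zero_le_one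
        (by
          refine (ENNReal.ofReal_toReal hMtop).symm.le.trans (ENNReal.ofReal_le_ofReal ?_)
          linarith [Real.add_one_le_exp ((M ω).toReal - 1)]) hν (μ : Measure T)
      rwa [ENNReal.ofReal_one, mul_one, ENNReal.ofReal_toReal hMtop] at h
    have hRm : Measurable fun p : Ω × T =>
        ENNReal.ofReal (‖f₀ - EWA.linEst (P p.2) (f₀ + W p.1)‖ ^ 2) :=
      ENNReal.measurable_ofReal.comp (((EWA.measurable_linEst
        (fun i j => (hPmeas i j).comp measurable_snd)
        (hY.comp measurable_fst)).const_sub f₀).norm.pow_const 2)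
    have hint := lintegral_mono (μ := Pr) hpt
    rw [lintegral_add_right _ measurable_const, lintegral_const, measure_univ, mul_one,
      lintegral_add_right _ ((hMm.const_add _).const_mul _),
      lintegral_add_right _ measurable_const, lintegral_const, measure_univ, mul_one,
      lintegral_const_mul' _ _ ENNReal.ofReal_ne_top,
      lintegral_const_mul' _ _ ENNReal.ofReal_ne_top,
      lintegral_add_right _ hMm, lintegral_const, measure_univ, mul_one,
      lintegral_lintegral_swap hRm.aemeasurable] at hint
    refine (ENNReal.add_le_add_iff_right (a := b) ENNReal.ofReal_ne_top).1 (hint.trans ?_)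
    rw [mul_assoc 2 β, ENNReal.ofReal_mul zero_le_two, ENNReal.ofReal_ofNat, ← hb,
      mul_add, ← add_assoc, mul_left_comm b 2, mul_assoc 2 b]
    gcongr
    exact mul_le_of_le_one_right zero_le hM1
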